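/- **Languages.** Let $\mathtt{Prop}$ be a countably infinite set of propositional variables. Classical formulas are built from $\mathtt{Prop}$ with ${\sim}$ and $\wedge$ ($\vee$, $\supset$, $\top$, $\bot$ are the usual abbreviations); $\mathsf{CPL}\vdash\phi$ means that $\phi$ is a classical tautology. Two-layered formulas are $\alpha::=\mathtt{B}\phi\mid\alpha\wedge\alpha\mid\alpha\vee\alpha\mid\alpha\to_{\mathsf G}\alpha\mid\alpha\prec_{\mathsf G}\alpha$ with $\phi$ classical, and for a fixed atom $\beta=\mathtt{B}p$ we put $\top_{\mathsf G}:=\beta\to_{\mathsf G}\beta$, $\bot_{\mathsf G}:=\beta\prec_{\mathsf G}\beta$, ${\sim}_{\mathsf G}\alpha:=\alpha\to_{\mathsf G}\bot_{\mathsf G}$, $\triangle\alpha:=(\top_{\mathsf G}\prec_{\mathsf G}\alpha)\to_{\mathsf G}\bot_{\mathsf G}$, $\alpha\leftrightarrow_{\mathsf G}\alpha':=(\alpha\to_{\mathsf G}\alpha')\wedge(\alpha'\to_{\mathsf G}\alpha)$. **Semantics.** A frame is $\mathbb F=\langle W,\mu\rangle$ with $W\neq\varnothing$ and $\mu:2^W\to[0,1]$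 an uncertainty measure, i.e. $\mu$ is monotone with respect to $\subseteq$ and $\mu(\varnothing)<\mu(W)$. A valuation $v:\mathtt{Prop}\to2^W$ extends to $\|\phi\|\subseteq W$ classically and induces $e(\mathtt{B}\phi)=\mu(\|\phi\|)$, where $\wedge,\vee$ are interpreted as $\min,\max$, $a\to_{\mathsf G}b$ is $1$ if $a\le b$ and $b$ otherwise, and $a\prec_{\mathsf G}b$ is $0$ if $a\le b$ and $a$ otherwise. $\mathbb F\models\alpha$ means $e(\alpha)=1$ for all $v$ on $\mathbb F$. The measure $\mu$ satisfies the Kraft–Pratt–Seidenberg conditions if for all $m\in\mathbb N$ and $X_0,\dots,X_m,Y_0,\dots,Y_m\subseteq W$: if $\mu(X_j)\le\mu(Y_j)$ for all $j<m$ and every $w\in W$ belongs to as many $X_i$'s as $Y_i$'s, then $\mu(X_m)\ge\mu(Y_m)$; then $\mathbb F$ is called a $\mathsf{QPG}$ frame. $\Xi\models_{\mathsf{QPG}}\alpha$ means that $\inf\{e(\gamma):\gamma\in\Xi\}\le e(\alpha)$ (infimum in $[0,1]$) for every valuation on every $\mathsf{QPG}$ frame. **Axioms.** $\mathsf{KPS}$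 is the set of all formulas ($m\in\mathbb N$, $\phi_i,\chi_i$ classical) $$\mathsf{KPS}_m:\quad (\phi_0,\dots,\phi_m\,\mathtt{E}_{\mathsf G}\,\chi_0,\dots,\chi_m)\wedge\bigwedge_{i=0}^{m-1}\triangle(\mathtt{B}\phi_i\to_{\mathsf G}\mathtt{B}\chi_i)\ \to_{\mathsf G}\ \triangle(\mathtt{B}\chi_m\to_{\mathsf G}\mathtt{B}\phi_m),$$ where, with $M=\{0,\dots,m\}$, $\phi_0,\dots,\phi_m\,\mathtt{E}_{\mathsf G}\,\chi_0,\dots,\chi_m$ is $$\triangle\Big(\mathtt{B}\Big(\bigvee_{i=0}^{m+1}\bigvee_{\substack{K,L\subseteq M\\|K|=|L|=i}}\Big(\bigwedge_{k\in K}{\sim}\phi_k\wedge\bigwedge_{k\in M\setminus K}\phi_k\wedge\bigwedge_{l\in L}{\sim}\chi_l\wedge\bigwedge_{l\in M\setminus L}\chi_l\Big)\Big)\leftrightarrow_{\mathsf G}\mathtt{B}\top\Big).$$ **Calculus.** $\mathcal H\mathsf{QG}\oplus\mathsf{KPS}$ has as axioms all members of $\mathsf{KPS}$ and, for all classical $\phi,\chi$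 and two-layered $\alpha,\beta,\gamma$ (writing $\to,\prec,{\sim}$ for $\to_{\mathsf G},\prec_{\mathsf G},{\sim}_{\mathsf G}$): - ${\sim}\triangle(\mathtt{B}\phi\to\mathtt{B}\chi)$ if $\mathsf{CPL}\vdash\phi$ and $\mathsf{CPL}\vdash{\sim}\chi$; $\ \mathtt{B}\phi\to\mathtt{B}\chi$ if $\mathsf{CPL}\vdash\phi\supset\chi$; - $(\alpha\to\beta)\to((\beta\to\gamma)\to(\alpha\to\gamma))$; $\ \alpha\to(\alpha\vee\beta)$; $\ \beta\to(\alpha\vee\beta)$; $\ (\alpha\to\gamma)\to((\beta\to\gamma)\to((\alpha\vee\beta)\to\gamma))$; - $(\alpha\wedge\beta)\to\alpha$; $\ (\alpha\wedge\beta)\to\beta$; $\ (\alpha\to\beta)\to((\alpha\to\gamma)\to(\alpha\to(\beta\wedge\gamma)))$; - $(\alpha\to(\beta\to\gamma))\to((\alpha\wedge\beta)\to\gamma)$; $\ ((\alpha\wedge\beta)\to\gamma)\to(\alpha\to(\beta\to\gamma))$; $\ (\alpha\to\beta)\to({\sim}\beta\to{\sim}\alpha)$; - $(\alpha\prec\beta)\to(\top_{\mathsf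 G}\prec(\alpha\to\beta))$; $\ {\sim}(\alpha\prec\beta)\to(\alpha\to\beta)$; $\ \alpha\to(\beta\vee(\alpha\prec\beta))$; $\ ((\alpha\prec\beta)\prec\gamma)\to(\alpha\prec(\beta\vee\gamma))$; - $(\alpha\to\beta)\vee(\beta\to\alpha)$; $\ {\sim}((\alpha\prec\beta)\wedge(\beta\prec\alpha))$. Its rules are modus ponens and $\triangle$-necessitation (from $\vdash\alpha$ infer $\vdash\triangle\alpha$, for $\alpha$ proved without premises). $\Xi\vdash\alpha$ denotes derivability from premises $\Xi$, and $\vdash\alpha$ means $\varnothing\vdash\alpha$. **Theorem.** 1. For every frame $\mathbb F=\langle W,\mu\rangle$: $\mathbb F\models\alpha$ for all $\alpha\in\mathsf{KPS}$ if and only if $\mu$ satisfies the Kraft–Pratt–Seidenberg conditions. 2. $\mathcal H\mathsf{QG}\oplus\mathsf{KPS}$ is the logic of $\mathsf{QPG}$ frames: for every two-layered formula $\alpha$, $\vdash\alpha$ if and only if $\mathbb F\models\alpha$ for every $\mathsf{QPG}$ frame $\mathbb F$. Moreover, for every finite set $\Xi$ of two-layered formulas, $\Xi\vdash\alpha$ if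 and only if $\Xi\models_{\mathsf{QPG}}\alpha$. -/

import Mathlib

universe u

namespace QualProb

/-! ### Inner layer: classical propositional logic over `{∼, ∧}` -/

/-- Classical formulas; the propositional variables are indexed by `ℕ`. -/
inductive CPL : Type
  | var : ℕ → CPL
  | neg : CPL → CPL
  | and : CPL → CPL → CPL

namespace CPL

def or (φ χ : CPL) : CPL := neg (and (neg φ) (neg χ))

def imp (φ χ : CPL) : CPL := or (neg φ) χ

def top : CPL := imp (var 0) (var 0)

def bot : CPL := neg top

/-- Conjunction of a list; the empty conjunction is `⊤`. -/
def bigAnd (l : List CPL) : CPL := l.foldr and top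

/-- Disjunction of a list; the empty disjunction is `⊥`. -/
def bigOr (l : List CPL) : CPL := l.foldr or bot

/-- Conjunction of `f i` over `i ∈ s` (in some fixed order). -/
noncomputable def conjOver {ι : Type} (s : Finset ι) (f : ι → CPL) : CPL :=
  bigAnd (s.toList.map f)

/-- Disjunction of `f i` over `i ∈ s` (in some fixed order). -/
noncomputable def disjOver {ι : Type} (s : Finset ι) (f : ι → CPL) : CPL :=
  bigOr (s.toList.map f)

/-- Truth at a state `x` under a valuation `v : Prop → 2^W`. -/
def Sat {W : Type u} (v : ℕ → Set W) (x : W) : CPL → Prop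
  | var p => x ∈ v p
  | neg φ => ¬ Sat v x φ
  | and φ χ => Sat v x φ ∧ Sat v x χ

/-- The extension `‖φ‖` of a formula. -/
def ext {W : Type u} (v : ℕ → Set W) (φ : CPL) : Set W := {x | Sat v x φ}

/-- Truth of a formula under a two-valued assignment. -/
def Holds (a : ℕ → Prop) : CPL → Prop
  | var p => a p
  | neg φ => ¬ Holds a φ
  | and φ χ => Holds a φ ∧ Holds a χ

/-- `φ` is a theorem of classical propositional logic, i.e. a tautology. -/
def IsTheorem (φ : CPL) : Prop := ∀ a : ℕ → Prop, Holds a φ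

end CPL

/-! ### Outer layer: the two-layered language -/

/-- Two-layered formulas: atoms `B φ` with `φ` classical, combined by the
bi-Gödel connectives (`coimp α β` is the co-implication "`α` excludes `β`"). -/
inductive QG : Type
  | B : CPL → QG
  | and : QG → QG → QG
  | or : QG → QG → QG
  | imp : QG → QG → QG
  | coimp : QG → QG → QG

namespace QG

/-- `⊤_G`, of the form `α →_G α`. -/
def top : QG := imp (B (CPL.var 0)) (B (CPL.var 0))

/-- `⊥_G`, of the form `α` co-implies `α`. -/
def bot : QG := coimp (B (CPL.var 0)) (B (CPL.var 0))

/-- Gödel negation `∼_G α`. -/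
def neg (α : QG) : QG := imp α bot

/-- The operator `△`. -/
def delta (α : QG) : QG := imp (coimp top α) bot

def iff (α β : QG) : QG := and (imp α β) (imp β α)

/-- Conjunction of a list; the empty conjunction is `⊤_G`. -/
def bigAnd (l : List QG) : QG := l.foldr and top

end QG

/-! ### Semantics -/

/-- The Gödel implication on `[0,1]`. -/
noncomputable def gImp (a b : unitInterval) : unitInterval :=
  if a ≤ b then 1 else b

/-- The Gödel co-implication on `[0,1]`. -/
noncomputable def gCoimp (b a : unitInterval) : unitInterval :=
  if b ≤ a then 0 else b

/-- An uncertainty frame: a nonempty set with an uncertainty measure, i.e. a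
`[0,1]`-valued set function that is monotone and non-trivial. -/
structure Frame : Type (u + 1) where
  W : Type u
  nonempty : Nonempty W
  μ : Set W → unitInterval
  mono : ∀ X Y : Set W, X ⊆ Y → μ X ≤ μ Y
  nontriv : μ ∅ < μ Set.univ

namespace Frame

/-- The value of a two-layered formula in the model given by a frame and a
valuation of the propositional variables. -/
noncomputable def eval (F : Frame.{u}) (v : ℕ → Set F.W) : QG → unitInterval
  | QG.B φ => F.μ (CPL.ext v φ)
  | QG.and α β => min (F.eval v α) (F.eval v β)
  | QG.or α β => max (F.eval v α) (F.eval v β)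
  | QG.imp α β => gImp (F.eval v α) (F.eval v β)
  | QG.coimp α β => gCoimp (F.eval v α) (F.eval v β)

/-- `F ⊨ α`. -/
def Validates (F : Frame.{u}) (α : QG) : Prop :=
  ∀ v : ℕ → Set F.W, F.eval v α = 1

/-- The Kraft–Pratt–Seidenberg conditions for the measure of a frame. -/
def SatisfiesKPS (F : Frame.{u}) : Prop :=
  ∀ (m : ℕ) (X Y : Fin (m + 1) → Set F.W),
    (∀ j : Fin m, F.μ (X j.castSucc) ≤ F.μ (Y j.castSucc)) →
    (∀ w : F.W, Set.ncard {i | w ∈ X i} = Set.ncard {i | w ∈ Y i}) →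
    F.μ (Y (Fin.last m)) ≤ F.μ (X (Fin.last m))

end Frame

/-- A `QPG` frame is an uncertainty frame with the Kraft–Pratt–Seidenberg conditions. -/
def IsQPGFrame (F : Frame.{u}) : Prop := F.SatisfiesKPS

/-- Entailment over the class of `QPG` frames: in every model on such a frame the
infimum (in `[0,1]`) of the values of the premises is at most the value of the conclusion. -/
def EntailsQPG (Ξ : Set QG) (α : QG) : Prop :=
  ∀ F : Frame.{u}, IsQPGFrame F → ∀ v : ℕ → Set F.W,
    sInf (F.eval v '' Ξ) ≤ F.eval v α

/-! ### The Kraft–Pratt–Seidenberg axioms -/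

/-- The classical formula saying that as many of the `φ i` as of the `χ i` are false. -/
noncomputable def sameCount {n : ℕ} (φ χ : Fin n → CPL) : CPL :=
  CPL.disjOver (Finset.range (n + 1)) fun i =>
    CPL.disjOver (Finset.powersetCard i Finset.univ ×ˢ Finset.powersetCard i Finset.univ)
      fun KL : Finset (Fin n) × Finset (Fin n) =>
        CPL.and
          (CPL.and (CPL.conjOver KL.1 fun k => CPL.neg (φ k)) (CPL.conjOver KL.1ᶜ φ))
          (CPL.and (CPL.conjOver KL.2 fun l => CPL.neg (χ l)) (CPL.conjOver KL.2ᶜ χ))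

/-- `φ_1, …, φ_n E_G χ_1, …, χ_n`. -/
noncomputable def eG {n : ℕ} (φ χ : Fin n → CPL) : QG :=
  QG.delta (QG.iff (QG.B (sameCount φ χ)) (QG.B CPL.top))

/-- The instance of `KPS_m` for the formulas `φ_0, …, φ_m` and `χ_0, …, χ_m`. -/
noncomputable def kps (m : ℕ) (φ χ : Fin (m + 1) → CPL) : QG :=
  QG.imp
    (QG.and (eG φ χ)
      (QG.bigAnd ((List.finRange m).map fun i =>
        QG.delta (QG.imp (QG.B (φ i.castSucc)) (QG.B (χ i.castSucc))))))
    (QG.delta (QG.imp (QG.B (χ (Fin.last m))) (QG.B (φ (Fin.last m)))))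

/-- All instances of all `KPS_m`. -/
def KPS : Set QG := {α | ∃ (m : ℕ) (φ χ : Fin (m + 1) → CPL), α = kps m φ χ}

/-! ### The calculus -/

/-- The axioms of the Hilbert calculus for bi-Gödel logic, instantiated with
two-layered formulas. -/
inductive BiGAxiom : QG → Prop
  | trans (α β γ : QG) : BiGAxiom ((α.imp β).imp ((β.imp γ).imp (α.imp γ)))
  | orLeft (α β : QG) : BiGAxiom (α.imp (α.or β))
  | orRight (α β : QG) : BiGAxiom (β.imp (α.or β))
  | orElim (α β γ : QG) : BiGAxiom ((α.imp γ).imp ((β.imp γ).imp ((α.or β).imp γ)))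
  | andLeft (α β : QG) : BiGAxiom ((α.and β).imp α)
  | andRight (α β : QG) : BiGAxiom ((α.and β).imp β)
  | andIntro (α β γ : QG) : BiGAxiom ((α.imp β).imp ((α.imp γ).imp (α.imp (β.and γ))))
  | uncurry (α β γ : QG) : BiGAxiom ((α.imp (β.imp γ)).imp ((α.and β).imp γ))
  | curry (α β γ : QG) : BiGAxiom (((α.and β).imp γ).imp (α.imp (β.imp γ)))
  | contra (α β : QG) : BiGAxiom ((α.imp β).imp (β.neg.imp α.neg))
  | coimpTop (α β : QG) : BiGAxiom ((α.coimp β).imp (QG.top.coimp (α.imp β)))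
  | negCoimp (α β : QG) : BiGAxiom ((α.coimp β).neg.imp (α.imp β))
  | orCoimp (α β : QG) : BiGAxiom (α.imp (β.or (α.coimp β)))
  | coimpOr (α β γ : QG) : BiGAxiom (((α.coimp β).coimp γ).imp (α.coimp (β.or γ)))
  | prel (α β : QG) : BiGAxiom ((α.imp β).or (β.imp α))
  | coprel (α β : QG) : BiGAxiom ((α.coimp β).and (β.coimp α)).neg

/-- The axioms of `HQG`. -/
inductive HQGAxiom : QG → Prop
  | nontriv (φ χ : CPL) : φ.IsTheorem → χ.neg.IsTheorem →
      HQGAxiom (QG.delta ((QG.B φ).imp (QG.B χ))).neg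
  | reg (φ χ : CPL) : (φ.imp χ).IsTheorem → HQGAxiom ((QG.B φ).imp (QG.B χ))
  | biG (α : QG) : BiGAxiom α → HQGAxiom α

/-- `HQG` as a set of axioms. -/
def HQG : Set QG := {α | HQGAxiom α}

/-- Derivability of a formula from premises `Ξ` in the calculus with axioms `Ax`, modus
ponens, and `△`-necessitation; the latter applies to formulas proved without premises. -/
inductive Derives (Ax : Set QG) : Set QG → QG → Prop
  | ax {Ξ : Set QG} {α : QG} : α ∈ Ax → Derives Ax Ξ α
  | prem {Ξ : Set QG} {α : QG} : α ∈ Ξ → Derives Ax Ξ α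
  | mp {Ξ : Set QG} {α β : QG} : Derives Ax Ξ α → Derives Ax Ξ (α.imp β) → Derives Ax Ξ β
  | nec {Ξ : Set QG} {α : QG} : Derives Ax ∅ α → Derives Ax Ξ α.delta

end QualProb

namespace QualProb

/-! ### The bi-Gödel operations on `[0,1]` -/

theorem gImp_eq_one_iff {a b : unitInterval} : gImp a b = 1 ↔ a ≤ b := by
  unfold gImp
  split_ifs with h
  · simp [h]
  · refine iff_of_false (fun hb => h ?_) h
    rw [hb]
    exact unitInterval.le_one'

theorem le_gImp_iff {a b c : unitInterval} : c ≤ gImp a b ↔ min c a ≤ b := by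
  unfold gImp
  split_ifs with h
  · exact iff_of_true unitInterval.le_one' (min_le_of_right_le h)
  · rw [min_le_iff]
    exact ⟨Or.inl, fun h' => h'.resolve_right h⟩

theorem gCoimp_le_iff {a b c : unitInterval} : gCoimp a b ≤ c ↔ a ≤ max b c := by
  unfold gCoimp
  split_ifs with h
  · exact iff_of_true unitInterval.nonneg' (le_max_of_le_left h)
  · rw [le_max_iff]
    exact ⟨Or.inr, fun h' => h'.resolve_left h⟩

theorem gImp_self (a : unitInterval) : gImp a a = 1 := gImp_eq_one_iff.2 le_rfl

theorem gCoimp_self (a : unitInterval) : gCoimp a a = 0 := if_pos le_rfl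

namespace Frame

variable (F : Frame.{u}) (v : ℕ → Set F.W)

@[simp] theorem eval_B (φ : CPL) : F.eval v (.B φ) = F.μ (CPL.ext v φ) := rfl
@[simp] theorem eval_and (α β : QG) :
    F.eval v (.and α β) = min (F.eval v α) (F.eval v β) := rfl
@[simp] theorem eval_or (α β : QG) :
    F.eval v (.or α β) = max (F.eval v α) (F.eval v β) := rfl
@[simp] theorem eval_imp (α β : QG) :
    F.eval v (.imp α β) = gImp (F.eval v α) (F.eval v β) := rfl
@[simp] theorem eval_coimp (α β : QG) :
    F.eval v (.coimp α β) = gCoimp (F.eval v α) (F.eval v β) := rfl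
@[simp] theorem eval_top : F.eval v .top = 1 := gImp_self _
@[simp] theorem eval_bot : F.eval v .bot = 0 := gCoimp_self _

theorem eval_neg (α : QG) :
    F.eval v α.neg = if F.eval v α = 0 then 1 else 0 := by
  simp only [QG.neg, eval_imp, eval_bot, gImp]
  congr 1
  exact propext ⟨fun h => le_antisymm h unitInterval.nonneg', fun h => h.le⟩

theorem eval_delta (α : QG) :
    F.eval v α.delta = if F.eval v α = 1 then 1 else 0 := by
  have : (1 ≤ F.eval v α) = (F.eval v α = 1) :=
    propext ⟨fun h => le_antisymm unitInterval.le_one' h, fun h => h.ge⟩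
  simp only [QG.delta, eval_imp, eval_bot, eval_coimp, eval_top, gCoimp, this]
  by_cases h : F.eval v α = 1 <;> simp [h, gImp]

theorem eval_imp_eq_one {α β : QG} :
    F.eval v (.imp α β) = 1 ↔ F.eval v α ≤ F.eval v β := gImp_eq_one_iff

theorem eval_iff_eq_one {α β : QG} :
    F.eval v (.iff α β) = 1 ↔ F.eval v α = F.eval v β := by
  rw [QG.iff, eval_and, le_antisymm_iff (a := F.eval v α), ← eval_imp_eq_one, ← eval_imp_eq_one]
  constructor
  · intro h
    exact ⟨le_antisymm unitInterval.le_one' (h ▸ min_le_left _ _),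
      le_antisymm unitInterval.le_one' (h ▸ min_le_right _ _)⟩
  · rintro ⟨h, h'⟩
    rw [h, h', min_self]

theorem le_eval_bigAnd {c : unitInterval} {l : List QG} :
    c ≤ F.eval v (QG.bigAnd l) ↔ ∀ α ∈ l, c ≤ F.eval v α := by
  induction l with
  | nil => simpa [QG.bigAnd] using unitInterval.le_one'
  | cons a l ih =>
    rw [show QG.bigAnd (a :: l) = a.and (QG.bigAnd l) from rfl, eval_and, le_min_iff, ih]
    simp

theorem one_le_eval {α : QG} : 1 ≤ F.eval v α ↔ F.eval v α = 1 :=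
  ⟨fun h => le_antisymm unitInterval.le_one' h, fun h => h.ge⟩

theorem eval_delta_eq_one {α : QG} : F.eval v α.delta = 1 ↔ F.eval v α = 1 := by
  rw [eval_delta]; split_ifs with h <;> simp [h]

end Frame

/-! ### Semantics of classical formulas -/

namespace CPL

variable {W : Type u} (v : ℕ → Set W) (x : W)

theorem sat_eq_holds (φ : CPL) : Sat v x φ ↔ Holds (fun p => x ∈ v p) φ := by
  induction φ with
  | var p => exact Iff.rfl
  | neg φ ih => exact not_congr ih
  | and φ χ ih ih' => exact and_congr ih ih'

variable (a : ℕ → Prop)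

@[simp] theorem holds_neg (φ : CPL) : Holds a (.neg φ) ↔ ¬ Holds a φ := Iff.rfl

@[simp] theorem holds_and (φ χ : CPL) : Holds a (.and φ χ) ↔ Holds a φ ∧ Holds a χ := Iff.rfl

@[simp] theorem holds_or (φ χ : CPL) : Holds a (.or φ χ) ↔ Holds a φ ∨ Holds a χ := by
  simp only [or, holds_neg, holds_and]; tauto

@[simp] theorem holds_imp (φ χ : CPL) : Holds a (.imp φ χ) ↔ (Holds a φ → Holds a χ) := by
  simp only [imp, holds_neg, holds_or]; tauto

@[simp] theorem holds_top : Holds a .top := by simp [top]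

@[simp] theorem holds_bot : ¬ Holds a .bot := by simp [bot]

theorem holds_conjOver {ι : Type} (s : Finset ι) (f : ι → CPL) :
    Holds a (conjOver s f) ↔ ∀ i ∈ s, Holds a (f i) := by
  have (l : List CPL) : Holds a (bigAnd l) ↔ ∀ φ ∈ l, Holds a φ := by
    induction l with
    | nil => simp [bigAnd]
    | cons b l ih => rw [show bigAnd (b :: l) = b.and (bigAnd l) from rfl]; simp [ih]
  simp [conjOver, this]

theorem holds_disjOver {ι : Type} (s : Finset ι) (f : ι → CPL) :
    Holds a (disjOver s f) ↔ ∃ i ∈ s, Holds a (f i) := by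
  have (l : List CPL) : Holds a (bigOr l) ↔ ∃ φ ∈ l, Holds a φ := by
    induction l with
    | nil => simp [bigOr]
    | cons b l ih => rw [show bigOr (b :: l) = b.or (bigOr l) from rfl]; simp [ih]
  simp [disjOver, this]

theorem holds_sameCount {n : ℕ} (φ χ : Fin n → CPL) :
    Holds a (sameCount φ χ) ↔
      Set.ncard {i | Holds a (φ i)} = Set.ncard {i | Holds a (χ i)} := by
  classical
  have key (ψ : Fin n → CPL) (K : Finset (Fin n)) :
      (Holds a (conjOver K fun k => (ψ k).neg) ∧ Holds a (conjOver Kᶜ ψ)) ↔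
        K = Finset.univ.filter fun i => ¬ Holds a (ψ i) := by
    simp only [holds_conjOver, holds_neg, Finset.mem_compl, Finset.ext_iff, Finset.mem_filter,
      Finset.mem_univ, true_and]
    exact ⟨fun h i => ⟨h.1 i, fun hi => by_contra fun hk => hi (h.2 i hk)⟩,
      fun h => ⟨fun i => (h i).1, fun i hi => by_contra fun hk => hi ((h i).2 hk)⟩⟩
  have card (ψ : Fin n → CPL) : Set.ncard {i | Holds a (ψ i)} +
      (Finset.univ.filter fun i => ¬ Holds a (ψ i)).card = n := by
    have h1 : Set.ncard {i | Holds a (ψ i)} =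
        (Finset.univ.filter fun i => Holds a (ψ i)).card := by
      rw [← Set.ncard_coe_finset]; congr 1; ext; simp
    rw [h1, Finset.card_filter_add_card_filter_not]; simp
  have h1 := card φ
  have h2 := card χ
  simp only [sameCount, holds_disjOver, holds_and, key]
  constructor
  · rintro ⟨i, -, ⟨K, L⟩, hKL, hK, hL⟩
    simp only [Finset.mem_product, Finset.mem_powersetCard] at hKL hK hL
    rw [← hK] at h1
    rw [← hL] at h2
    omega
  · intro h
    refine ⟨(Finset.univ.filter fun i => ¬ Holds a (φ i)).card, ?_,
      ⟨Finset.univ.filter fun i => ¬ Holds a (φ i),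
        Finset.univ.filter fun i => ¬ Holds a (χ i)⟩, ?_, rfl, rfl⟩
    · rw [Finset.mem_range]; omega
    · simp only [Finset.mem_product, Finset.mem_powersetCard, Finset.subset_univ, true_and]
      omega

theorem mem_ext_sameCount {n : ℕ} (φ χ : Fin n → CPL) :
    x ∈ ext v (sameCount φ χ) ↔
      Set.ncard {i | x ∈ ext v (φ i)} = Set.ncard {i | x ∈ ext v (χ i)} := by
  simp only [ext, Set.mem_ofPred_eq, sat_eq_holds, holds_sameCount]

theorem ext_of_isTheorem {φ : CPL} (h : φ.IsTheorem) : ext v φ = Set.univ :=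
  Set.eq_univ_of_forall fun x => (sat_eq_holds v x φ).2 (h _)

theorem ext_of_neg_isTheorem {φ : CPL} (h : φ.neg.IsTheorem) : ext v φ = ∅ :=
  Set.eq_empty_of_forall_notMem fun x hx => h _ ((sat_eq_holds v x φ).1 hx)

theorem ext_subset_of_isTheorem {φ χ : CPL} (h : (φ.imp χ).IsTheorem) :
    ext v φ ⊆ ext v χ := fun x hx =>
  (sat_eq_holds v x χ).2 ((holds_imp _ _ _).1 (h _) ((sat_eq_holds v x φ).1 hx))

theorem isTheorem_top : top.IsTheorem := fun a => holds_top a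

end CPL

/-! ### Frame correspondence for the Kraft–Pratt–Seidenberg axioms -/

namespace Frame

variable {F : Frame.{u}}

theorem eval_eG_eq_one (v : ℕ → Set F.W) {n : ℕ} (φ χ : Fin n → CPL) :
    F.eval v (eG φ χ) = 1 ↔ F.μ {w | Set.ncard {i | w ∈ CPL.ext v (φ i)} =
      Set.ncard {i | w ∈ CPL.ext v (χ i)}} = F.μ Set.univ := by
  have : CPL.ext v (sameCount φ χ) = {w | Set.ncard {i | w ∈ CPL.ext v (φ i)} =
      Set.ncard {i | w ∈ CPL.ext v (χ i)}} := by
    ext w; exact CPL.mem_ext_sameCount v w φ χ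
  rw [eG, eval_delta_eq_one, eval_iff_eq_one, eval_B, eval_B, this,
    CPL.ext_of_isTheorem v CPL.isTheorem_top]

theorem eval_bigAnd_delta_eq_one (v : ℕ → Set F.W) {m : ℕ} (φ χ : Fin (m + 1) → CPL) :
    F.eval v (QG.bigAnd ((List.finRange m).map fun i =>
        QG.delta (QG.imp (QG.B (φ i.castSucc)) (QG.B (χ i.castSucc))))) = 1 ↔
      ∀ i : Fin m, F.μ (CPL.ext v (φ i.castSucc)) ≤ F.μ (CPL.ext v (χ i.castSucc)) := by
  rw [← one_le_eval, le_eval_bigAnd]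
  simp [one_le_eval, eval_delta_eq_one, gImp_eq_one_iff]

/-- The value of a Kraft–Pratt–Seidenberg axiom is `1` exactly when its two-valued reading
holds. -/
theorem eval_kps_eq_one (v : ℕ → Set F.W) {m : ℕ} (φ χ : Fin (m + 1) → CPL) :
    F.eval v (kps m φ χ) = 1 ↔
      (F.μ {w | Set.ncard {i | w ∈ CPL.ext v (φ i)} =
        Set.ncard {i | w ∈ CPL.ext v (χ i)}} = F.μ Set.univ →
      (∀ i : Fin m, F.μ (CPL.ext v (φ i.castSucc)) ≤ F.μ (CPL.ext v (χ i.castSucc))) →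
      F.μ (CPL.ext v (χ (Fin.last m))) ≤ F.μ (CPL.ext v (φ (Fin.last m)))) := by
  rw [← eval_eG_eq_one, ← eval_bigAnd_delta_eq_one, kps, eval_imp_eq_one, eval_and]
  have two (α : QG) : F.eval v α.delta = 1 ∨ F.eval v α.delta = 0 := by
    rw [eval_delta]; split_ifs <;> simp
  by_cases h : F.μ (CPL.ext v (χ (Fin.last m))) ≤ F.μ (CPL.ext v (φ (Fin.last m)))
  · have hr : F.eval v (QG.delta (QG.imp (QG.B (χ (Fin.last m))) (QG.B (φ (Fin.last m))))) = 1 :=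
      (eval_delta_eq_one F v).2 ((eval_imp_eq_one F v).2 h)
    rw [hr]
    exact iff_of_true unitInterval.le_one' fun _ _ => h
  · have hr : F.eval v (QG.delta (QG.imp (QG.B (χ (Fin.last m))) (QG.B (φ (Fin.last m))))) = 0 :=
      (two _).resolve_left fun h1 =>
        h ((eval_imp_eq_one F v).1 ((eval_delta_eq_one F v).1 h1))
    rw [hr]
    constructor
    · intro h0 h1 h2
      rw [h1, h2, min_self] at h0
      exact absurd h0 (by simp)
    · intro H
      rcases two (QG.iff (QG.B (sameCount φ χ)) (QG.B CPL.top)) with h1 | h1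
      · have h2 : F.eval v (QG.bigAnd ((List.finRange m).map fun i =>
            QG.delta (QG.imp (QG.B (φ i.castSucc)) (QG.B (χ i.castSucc))))) ≠ 1 :=
          fun h2 => h (H h1 h2)
        rw [Ne, eval_bigAnd_delta_eq_one, not_forall] at h2
        obtain ⟨i, hi⟩ := h2
        refine min_le_of_right_le (((le_eval_bigAnd F v).1 le_rfl _
          (List.mem_map.2 ⟨i, List.mem_finRange i, rfl⟩)).trans ?_)
        exact ((two _).resolve_left fun h1 => hi ((eval_imp_eq_one F v (α := .B (φ i.castSucc))
          (β := .B (χ i.castSucc))).1 ((eval_delta_eq_one F v).1 h1))).le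
      · exact min_le_of_left_le h1.le

/-- A null set may be ignored when comparing set measures. -/
theorem SatisfiesKPS.le_inter (hF : F.SatisfiesKPS) {D : Set F.W} (hD : F.μ D = F.μ Set.univ)
    (X : Set F.W) : F.μ X ≤ F.μ (X ∩ D) := by
  have hDc : F.μ Dᶜ ≤ F.μ ∅ := by
    refine hF 1 ![Set.univ, ∅] ![D, Dᶜ] (fun j => ?_) (fun w => ?_)
    · fin_cases j; exact hD.ge
    · by_cases hw : w ∈ D
      · congr 1; ext i; fin_cases i <;> simp [hw]
      · have h1 : {i | w ∈ (![Set.univ, ∅] : Fin 2 → Set F.W) i} = {0} := by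
          ext i; fin_cases i <;> simp
        have h2 : {i | w ∈ (![D, Dᶜ] : Fin 2 → Set F.W) i} = {1} := by
          ext i; fin_cases i <;> simp [hw]
        simp only [Nat.reduceAdd] at *
        rw [h1, h2]; simp
  refine hF 1 ![X \ D, X ∩ D] ![∅, X] (fun j => ?_) (fun w => ?_)
  · fin_cases j
    exact (F.mono _ _ fun w hw => hw.2).trans hDc
  · by_cases hw : w ∈ D
    · congr 1; ext i; fin_cases i <;> simp [hw]
    · by_cases hX : w ∈ X
      · have h1 : {i | w ∈ (![X \ D, X ∩ D] : Fin 2 → Set F.W) i} = {0} := by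
          ext i; fin_cases i <;> simp [hw, hX]
        have h2 : {i | w ∈ (![∅, X] : Fin 2 → Set F.W) i} = {1} := by
          ext i; fin_cases i <;> simp [hX]
        simp only [Nat.reduceAdd] at *
        rw [h1, h2]; simp
      · congr 1; ext i; fin_cases i <;> simp [hX]

theorem SatisfiesKPS.validates (hF : F.SatisfiesKPS) {α : QG} (hα : α ∈ KPS) :
    F.Validates α := by
  obtain ⟨m, φ, χ, rfl⟩ := hα
  intro v
  rw [eval_kps_eq_one]
  intro hD hle
  set D := {w | Set.ncard {i | w ∈ CPL.ext v (φ i)} = Set.ncard {i | w ∈ CPL.ext v (χ i)}}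
    with hDdef
  refine (hF.le_inter hD _).trans (le_trans ?_ (F.mono (_ ∩ D) _ Set.inter_subset_left))
  refine hF m (fun i => CPL.ext v (φ i) ∩ D) (fun i => CPL.ext v (χ i) ∩ D) (fun j => ?_)
    (fun w => ?_)
  · exact (F.mono _ _ Set.inter_subset_left).trans ((hle j).trans (hF.le_inter hD _))
  · by_cases hw : w ∈ D
    · simp only [Set.mem_inter_iff, hw, and_true]
      exact hw
    · simp [hw]

theorem satisfiesKPS_of_validates (h : ∀ α ∈ KPS, F.Validates α) : F.SatisfiesKPS := by
  intro m X Y hle hcount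
  classical
  let v : ℕ → Set F.W := fun p =>
    if hp : p < m + 1 then X ⟨p, hp⟩ else
      if hq : p - (m + 1) < m + 1 then Y ⟨p - (m + 1), hq⟩ else ∅
  have hX (i : Fin (m + 1)) : CPL.ext v (.var i) = X i := by
    change v i = X i
    simp only [v, dif_pos i.2]
  have hY (i : Fin (m + 1)) : CPL.ext v (.var (m + 1 + i)) = Y i := by
    change v (m + 1 + i) = Y i
    have h1 : ¬ (m + 1 + (i : ℕ) < m + 1) := by omega
    have h2 : m + 1 + (i : ℕ) - (m + 1) = i := by omega
    simp only [v, dif_neg h1, h2, dif_pos i.2]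
  have key := h _ ⟨m, fun i => .var i, fun i => .var (m + 1 + i), rfl⟩ v
  rw [eval_kps_eq_one] at key
  simp only [hX, hY] at key
  refine key ?_ hle
  congr 1
  exact Set.eq_univ_of_forall hcount

end Frame

/-! ### Soundness -/

theorem BiGAxiom.sound {α : QG} (h : BiGAxiom α) (F : Frame.{u}) (v : ℕ → Set F.W) :
    F.eval v α = 1 := by
  cases h with
  | contra α β =>
    rw [Frame.eval_imp_eq_one]
    simp only [QG.neg, Frame.eval_imp, Frame.eval_bot, le_gImp_iff]
    grind [gImp]
  | negCoimp α β =>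
    rw [Frame.eval_imp_eq_one]
    by_cases h : F.eval v α ≤ F.eval v β
    · exact le_of_le_of_eq unitInterval.le_one' (gImp_eq_one_iff.2 h).symm
    · have h0 : F.eval v α ≠ 0 := fun h0 => h (h0 ▸ unitInterval.nonneg')
      have h1 : F.eval v (α.coimp β) = F.eval v α := if_neg h
      rw [Frame.eval_neg, if_neg (h1.trans_ne h0)]
      exact unitInterval.nonneg'
  | prel α β =>
    have := gImp_eq_one_iff (a := F.eval v α) (b := F.eval v β)
    have := gImp_eq_one_iff (a := F.eval v β) (b := F.eval v α)
    have h1 := @unitInterval.le_one' (gImp (F.eval v β) (F.eval v α))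
    have h2 := @unitInterval.le_one' (gImp (F.eval v α) (F.eval v β))
    rw [Frame.eval_or]
    simp only [Frame.eval_imp]
    grind
  | coprel α β =>
    rw [Frame.eval_neg, if_pos]
    simp only [Frame.eval_and, Frame.eval_coimp, gCoimp]
    have := @unitInterval.nonneg' (F.eval v α)
    have := @unitInterval.nonneg' (F.eval v β)
    grind
  | coimpTop α β =>
    rw [Frame.eval_imp_eq_one]
    have := @unitInterval.le_one' (F.eval v α)
    have := @unitInterval.le_one' (F.eval v β)
    simp only [Frame.eval_coimp, Frame.eval_imp, Frame.eval_top, gCoimp, gImp]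
    grind
  | coimpOr α β γ =>
    rw [Frame.eval_imp_eq_one]
    have := @unitInterval.nonneg' (F.eval v γ)
    simp only [Frame.eval_coimp, Frame.eval_or, gCoimp]
    grind
  | orCoimp α β =>
    rw [Frame.eval_imp_eq_one, Frame.eval_or, Frame.eval_coimp, ← gCoimp_le_iff]
  | _ =>
    rw [Frame.eval_imp_eq_one]
    simp only [Frame.eval_imp, Frame.eval_and, Frame.eval_or, le_gImp_iff]
    grind [gImp]

theorem HQGAxiom.sound {α : QG} (h : HQGAxiom α) (F : Frame.{u}) (v : ℕ → Set F.W) :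
    F.eval v α = 1 := by
  cases h with
  | nontriv φ χ hφ hχ =>
    rw [Frame.eval_neg, if_pos]
    rw [Frame.eval_delta, if_neg]
    rw [Frame.eval_imp_eq_one, Frame.eval_B, Frame.eval_B, CPL.ext_of_isTheorem v hφ,
      CPL.ext_of_neg_isTheorem v hχ]
    exact F.nontriv.not_ge
  | reg φ χ h => exact (Frame.eval_imp_eq_one F v).2 (F.mono _ _ (CPL.ext_subset_of_isTheorem v h))
  | biG α h => exact h.sound F v

theorem Derives.sInf_le_eval {Ξ : Set QG} {α : QG} (h : Derives (HQG ∪ KPS) Ξ α)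
    {F : Frame.{u}} (hF : F.SatisfiesKPS) (v : ℕ → Set F.W) :
    sInf (F.eval v '' Ξ) ≤ F.eval v α := by
  induction h with
  | ax h =>
    refine le_of_le_of_eq unitInterval.le_one' (Eq.symm ?_)
    rcases h with h | h
    · exact HQGAxiom.sound h F v
    · exact hF.validates h v
  | prem h => exact sInf_le (Set.mem_image_of_mem _ h)
  | mp _ _ ih ih' => exact (le_min le_rfl ih).trans (le_gImp_iff.1 ih')
  | nec _ ih =>
    rw [Set.image_empty, sInf_empty] at ih
    refine le_of_le_of_eq unitInterval.le_one' (Eq.symm ?_)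
    exact (Frame.eval_delta_eq_one F v).2 ((Frame.one_le_eval F v).1 ih)

/-! ### Theories of bi-Gödel logic -/

/-- A set of two-layered formulas that contains the bi-Gödel axioms and is closed under modus
ponens and `△`-necessitation. -/
structure IsTheory (T : Set QG) : Prop where
  ax {α : QG} : BiGAxiom α → α ∈ T
  mp {α β : QG} : α ∈ T → α.imp β ∈ T → β ∈ T
  nec {α : QG} : α ∈ T → α.delta ∈ T

namespace IsTheory

variable {T : Set QG} {α β γ δ : QG}

theorem imp_trans (hT : IsTheory T) (h : α.imp β ∈ T) (h' : β.imp γ ∈ T) : α.imp γ ∈ T :=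
  hT.mp h' (hT.mp h (hT.ax (.trans _ _ _)))

theorem weaken (hT : IsTheory T) (α β : QG) : α.imp (β.imp α) ∈ T :=
  hT.mp (hT.ax (.andLeft _ _)) (hT.ax (.curry _ _ _))

theorem imp_of_mem (hT : IsTheory T) (h : β ∈ T) : α.imp β ∈ T := hT.mp h (hT.weaken _ _)

theorem imp_refl (hT : IsTheory T) (α : QG) : α.imp α ∈ T :=
  hT.mp (hT.weaken α α) (hT.mp (hT.ax (.andRight _ _)) (hT.ax (.curry _ _ _)))

theorem top_mem (hT : IsTheory T) : QG.top ∈ T := hT.imp_refl _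

theorem imp_and (hT : IsTheory T) (h : α.imp β ∈ T) (h' : α.imp γ ∈ T) : α.imp (β.and γ) ∈ T :=
  hT.mp h' (hT.mp h (hT.ax (.andIntro _ _ _)))

theorem imp_mp (hT : IsTheory T) (h : α.imp (β.imp γ) ∈ T) (h' : α.imp β ∈ T) : α.imp γ ∈ T :=
  hT.imp_trans (hT.imp_and (hT.imp_refl _) h') (hT.mp h (hT.ax (.uncurry _ _ _)))

theorem curry (hT : IsTheory T) (h : (α.and β).imp γ ∈ T) : α.imp (β.imp γ) ∈ T :=
  hT.mp h (hT.ax (.curry _ _ _))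

theorem and_left (hT : IsTheory T) (α β : QG) : (α.and β).imp α ∈ T := hT.ax (.andLeft _ _)

theorem and_right (hT : IsTheory T) (α β : QG) : (α.and β).imp β ∈ T := hT.ax (.andRight _ _)

theorem or_left (hT : IsTheory T) (α β : QG) : α.imp (α.or β) ∈ T := hT.ax (.orLeft _ _)

theorem or_right (hT : IsTheory T) (α β : QG) : β.imp (α.or β) ∈ T := hT.ax (.orRight _ _)

theorem or_imp (hT : IsTheory T) (h : α.imp γ ∈ T) (h' : β.imp γ ∈ T) : (α.or β).imp γ ∈ T :=
  hT.mp h' (hT.mp h (hT.ax (.orElim _ _ _)))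

theorem and_mem (hT : IsTheory T) (h : α ∈ T) (h' : β ∈ T) : α.and β ∈ T :=
  hT.mp h (hT.imp_and (hT.imp_refl _) (hT.imp_of_mem h'))

theorem or_mem_of_imp (hT : IsTheory T) (h : α.or β ∈ T) (hα : α.imp γ ∈ T) (hβ : β.imp δ ∈ T) :
    γ.or δ ∈ T :=
  hT.mp h (hT.or_imp (hT.imp_trans hα (hT.or_left _ _)) (hT.imp_trans hβ (hT.or_right _ _)))

theorem neg_imp_neg (hT : IsTheory T) (h : α.imp β ∈ T) : β.neg.imp α.neg ∈ T :=
  hT.mp h (hT.ax (.contra _ _))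

/-- Residuation for the co-implication. -/
theorem coimp_imp (hT : IsTheory T) (h : α.imp (β.or γ) ∈ T) : (α.coimp β).imp γ ∈ T := by
  have h1 : (α.coimp (β.or γ)).imp QG.bot ∈ T :=
    hT.imp_trans (hT.ax (.coimpTop _ _)) (hT.nec h)
  exact hT.mp (hT.imp_trans (hT.ax (.coimpOr _ _ _)) h1) (hT.ax (.negCoimp _ _))

theorem bot_imp (hT : IsTheory T) (α : QG) : QG.bot.imp α ∈ T := hT.coimp_imp (hT.or_left _ _)

theorem delta_imp (hT : IsTheory T) (α : QG) : α.delta.imp α ∈ T :=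
  hT.imp_mp (hT.ax (.negCoimp _ _)) (hT.imp_of_mem hT.top_mem)

theorem delta_imp_delta (hT : IsTheory T) (h : α.imp β ∈ T) : α.delta.imp β.delta ∈ T := by
  refine hT.neg_imp_neg (hT.coimp_imp ?_)
  exact hT.imp_trans (hT.ax (.orCoimp QG.top α))
    (hT.or_imp (hT.imp_trans h (hT.or_left _ _)) (hT.or_right _ _))

/-- `△` distributes over provable disjunctions. -/
theorem delta_or_delta (hT : IsTheory T) (h : α.or β ∈ T) : α.delta.or β.delta ∈ T := by
  have hα : (QG.top.coimp α).imp (β.coimp α) ∈ T :=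
    hT.coimp_imp (hT.imp_of_mem (hT.mp h (hT.or_imp (hT.or_left _ _) (hT.ax (.orCoimp _ _)))))
  have hβ : (QG.top.coimp β).imp (α.coimp β) ∈ T :=
    hT.coimp_imp (hT.imp_of_mem (hT.mp h (hT.or_imp (hT.ax (.orCoimp _ _)) (hT.or_left _ _))))
  have key : ((QG.top.coimp α).and (QG.top.coimp β)).imp QG.bot ∈ T :=
    hT.imp_trans (hT.imp_and (hT.imp_trans (hT.and_left _ _) hα)
      (hT.imp_trans (hT.and_right _ _) hβ)) (hT.ax (.coprel _ _))
  refine hT.or_mem_of_imp (hT.ax (.prel (QG.top.coimp α) (QG.top.coimp β)))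
    (hT.curry ?_) (hT.curry ?_)
  · exact hT.imp_trans (hT.imp_and (hT.and_right _ _)
      (hT.imp_mp (hT.and_left _ _) (hT.and_right _ _))) key
  · exact hT.imp_trans (hT.imp_and (hT.imp_mp (hT.and_left _ _) (hT.and_right _ _))
      (hT.and_right _ _)) key

theorem neg_or_neg_neg (hT : IsTheory T) (α : QG) : α.neg.or α.neg.neg ∈ T := by
  refine hT.or_mem_of_imp (hT.ax (.prel α α.neg)) (hT.curry ?_) (hT.curry ?_)
  · exact hT.imp_mp (hT.imp_mp (hT.and_left _ _) (hT.and_right _ _)) (hT.and_right _ _)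
  · exact hT.imp_mp (hT.and_right _ _) (hT.imp_mp (hT.and_left _ _) (hT.and_right _ _))

theorem delta_imp_delta_delta (hT : IsTheory T) (α : QG) : α.delta.imp α.delta.delta ∈ T := by
  have h : α.delta.or α.delta.neg ∈ T := hT.neg_or_neg_neg _
  have h' := hT.or_mem_of_imp (hT.delta_or_delta h) (hT.imp_refl _) (hT.delta_imp _)
  refine hT.mp h' (hT.or_imp (hT.weaken _ _) (hT.curry ?_))
  exact hT.imp_trans (hT.imp_mp (hT.and_left _ _) (hT.and_right _ _)) (hT.bot_imp _)

/-- The theory generated by adding `α` to a theory. -/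
theorem extend (hT : IsTheory T) (α : QG) : IsTheory {β | α.delta.imp β ∈ T} where
  ax h := hT.imp_of_mem (hT.ax h)
  mp h h' := hT.imp_mp h' h
  nec h := hT.imp_trans (hT.delta_imp_delta_delta α) (hT.delta_imp_delta h)

/-- Every formula outside a theory is avoided by some prime theory extending it. -/
theorem exists_prime (hT : IsTheory T) (hα : α ∉ T) : ∃ P, T ⊆ P ∧ IsTheory P ∧ α ∉ P ∧
    ∀ β γ : QG, β.or γ ∈ P → β ∈ P ∨ γ ∈ P := by
  obtain ⟨P, hTP, hP⟩ := zorn_subset_nonempty {S | IsTheory S ∧ α ∉ S} (by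
    intro c hc hchain hne
    refine ⟨⋃₀ c, ⟨⟨?_, ?_, ?_⟩, ?_⟩, fun s hs => Set.subset_sUnion_of_mem hs⟩
    · intro β h
      obtain ⟨S, hS⟩ := hne
      exact ⟨S, hS, (hc hS).1.ax h⟩
    · rintro β γ ⟨S, hS, h⟩ ⟨S', hS', h'⟩
      rcases hchain.total hS hS' with hle | hle
      · exact ⟨S', hS', (hc hS').1.mp (hle h) h'⟩
      · exact ⟨S, hS, (hc hS).1.mp h (hle h')⟩
    · rintro β ⟨S, hS, h⟩
      exact ⟨S, hS, (hc hS).1.nec h⟩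
    · rintro ⟨S, hS, h⟩
      exact (hc hS).2 h) T ⟨hT, hα⟩
  have hPT := hP.prop.1
  have key (β : QG) (hβ : β ∉ P) : β.delta.imp α ∈ P := by
    by_contra hcon
    have hmem : {γ | β.delta.imp γ ∈ P} ∈ {S | IsTheory S ∧ α ∉ S} := ⟨hPT.extend β, hcon⟩
    exact hβ (hP.le_of_ge hmem (fun γ hγ => hPT.imp_of_mem hγ) (hPT.delta_imp β))
  refine ⟨P, hTP, hPT, hP.prop.2, fun β γ h => ?_⟩
  by_contra! hcon
  exact hP.prop.2 (hPT.mp (hPT.delta_or_delta h) (hPT.or_imp (key β hcon.1) (key γ hcon.2)))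

end IsTheory

/-! ### Countability of the language -/

/-- An injective coding of classical formulas by natural numbers. -/
def CPL.code : CPL → ℕ
  | .var p => Nat.pair 0 p
  | .neg φ => Nat.pair 1 φ.code
  | .and φ χ => Nat.pair 2 (Nat.pair φ.code χ.code)

theorem CPL.code_injective : Function.Injective CPL.code := by
  intro φ
  induction φ with
  | var p => intro χ h; cases χ <;> simp_all [code, Nat.pair_eq_pair]
  | neg φ ih =>
    intro χ h
    cases χ <;> simp only [code, Nat.pair_eq_pair] at h <;> first | omega | skip
    exact congrArg _ (ih h.2)
  | and φ φ' ih ih' =>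
    intro χ h
    cases χ <;> simp only [code, Nat.pair_eq_pair] at h <;> first | omega | skip
    exact congrArg₂ _ (ih h.2.1) (ih' h.2.2)

/-- An injective coding of two-layered formulas by natural numbers. -/
def QG.code : QG → ℕ
  | .B φ => Nat.pair 0 φ.code
  | .and α β => Nat.pair 1 (Nat.pair α.code β.code)
  | .or α β => Nat.pair 2 (Nat.pair α.code β.code)
  | .imp α β => Nat.pair 3 (Nat.pair α.code β.code)
  | .coimp α β => Nat.pair 4 (Nat.pair α.code β.code)

theorem QG.code_injective : Function.Injective QG.code := by
  intro α
  induction α with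
  | B φ =>
    intro β h
    cases β <;> simp only [code, Nat.pair_eq_pair] at h <;> first | omega | skip
    exact congrArg _ (CPL.code_injective h.2)
  | _ α α' ih ih' =>
    intro β h
    cases β <;> simp only [code, Nat.pair_eq_pair] at h <;> first | omega | skip
    exact congrArg₂ _ (ih h.2.1) (ih' h.2.2)

instance : Countable QG := QG.code_injective.countable

/-! ### The chain of a prime theory -/

/-- A countable total preorder with least element `b` and strictly greater greatest element `t`
is represented by a function to `[0,1]` sending `b` to `0` and `t` to `1`. -/
theorem exists_unitInterval_representation {A : Type*} [Countable A] (r : A → A → Prop)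
    (hrefl : ∀ x, r x x) (htrans : ∀ x y z, r x y → r y z → r x z) (htotal : ∀ x y, r x y ∨ r y x)
    (b t : A) (hb : ∀ x, r b x) (ht : ∀ x, r x t) (htb : ¬ r t b) :
    ∃ g : A → unitInterval, (∀ x y, g x ≤ g y ↔ r x y) ∧ g b = 0 ∧ g t = 1 := by
  classical
  let : Preorder A := { le := r, le_refl := hrefl, le_trans := htrans }
  have : Std.Total (α := A) (· ≤ ·) := ⟨htotal⟩
  have : Countable (Antisymmetrization A (· ≤ ·)) := Quotient.countable
  obtain ⟨f⟩ := Order.embedding_from_countable_to_dense (Antisymmetrization A (· ≤ ·)) ℝ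
  let k : A → ℝ := fun x => f (toAntisymmetrization (· ≤ ·) x)
  have hk (x y : A) : k x ≤ k y ↔ r x y := by
    simp only [k, f.le_iff_le, toAntisymmetrization_le_toAntisymmetrization_iff]
    exact Iff.rfl
  have hpos : 0 < k t - k b := sub_pos.2 (not_le.1 fun h => htb ((hk _ _).1 h))
  refine ⟨fun x => ⟨(k x - k b) / (k t - k b), ?_, ?_⟩, fun x y => ?_, ?_, ?_⟩
  · exact div_nonneg (sub_nonneg.2 ((hk _ _).2 (hb x))) hpos.le
  · rw [div_le_one hpos]
    exact sub_le_sub_right ((hk _ _).2 (ht x)) _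
  · change (k x - k b) / (k t - k b) ≤ (k y - k b) / (k t - k b) ↔ r x y
    rw [div_le_div_iff_of_pos_right hpos, sub_le_sub_iff_right, hk]
  · ext; simp
  · ext; simp [hpos.ne']

/-- A prime theory that avoids some formula linearly orders the two-layered formulas, and the
order is represented by a homomorphism to `[0,1]`. -/
theorem IsTheory.exists_hom {P : Set QG} (hP : IsTheory P) {α : QG} (hα : α ∉ P)
    (hprime : ∀ β γ : QG, β.or γ ∈ P → β ∈ P ∨ γ ∈ P) :
    ∃ g : QG → unitInterval, (∀ β γ, g β ≤ g γ ↔ β.imp γ ∈ P) ∧ g α ≠ 1 ∧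
      (∀ β γ, g (β.and γ) = min (g β) (g γ)) ∧ (∀ β γ, g (β.or γ) = max (g β) (g γ)) ∧
      (∀ β γ, g (β.imp γ) = gImp (g β) (g γ)) ∧
      (∀ β γ, g (β.coimp γ) = gCoimp (g β) (g γ)) := by
  have htotal (β γ : QG) : β.imp γ ∈ P ∨ γ.imp β ∈ P := hprime _ _ (hP.ax (.prel _ _))
  obtain ⟨g, hg, hbot, htop⟩ := exists_unitInterval_representation (fun β γ : QG => β.imp γ ∈ P)
    hP.imp_refl (fun _ _ _ => hP.imp_trans) htotal QG.bot QG.top hP.bot_imp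
    (fun _ => hP.imp_of_mem hP.top_mem)
    (fun h => hα (hP.mp (hP.mp hP.top_mem h) (hP.bot_imp α)))
  have hle (β γ : QG) (h : β.imp γ ∈ P) : g β ≤ g γ := (hg _ _).2 h
  have hone (β : QG) (h : β ∈ P) : g β = 1 :=
    le_antisymm unitInterval.le_one' (htop ▸ hle _ _ (hP.imp_of_mem h))
  refine ⟨g, hg, ?_, ?_, ?_, ?_, ?_⟩
  · intro h
    exact hα (hP.mp hP.top_mem ((hg _ _).1 (htop.trans h.symm).le))
  · intro β γ
    refine le_antisymm (le_min (hle _ _ (hP.and_left _ _)) (hle _ _ (hP.and_right _ _))) ?_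
    rcases htotal β γ with h | h
    · exact min_le_of_left_le (hle _ _ (hP.imp_and (hP.imp_refl _) h))
    · exact min_le_of_right_le (hle _ _ (hP.imp_and h (hP.imp_refl _)))
  · intro β γ
    refine le_antisymm ?_ (max_le (hle _ _ (hP.or_left _ _)) (hle _ _ (hP.or_right _ _)))
    rcases htotal β γ with h | h
    · exact le_max_of_le_right (hle _ _ (hP.or_imp h (hP.imp_refl _)))
    · exact le_max_of_le_left (hle _ _ (hP.or_imp (hP.imp_refl _) h))
  · intro β γ
    by_cases h : β.imp γ ∈ P
    · rw [hone _ h, gImp, if_pos (hle _ _ h)]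
    · rw [gImp, if_neg (mt (hg _ _).1 h)]
      refine le_antisymm (hle _ _ ?_) (hle _ _ (hP.weaken _ _))
      rcases htotal β (β.imp γ) with h' | h'
      · exact absurd (hP.imp_mp h' (hP.imp_refl _)) h
      · exact hP.imp_mp (hP.imp_refl _) h'
  · intro β γ
    by_cases h : β.imp γ ∈ P
    · rw [gCoimp, if_pos (hle _ _ h)]
      refine le_antisymm ?_ unitInterval.nonneg'
      rw [← hbot]
      exact hle _ _ (hP.coimp_imp (hP.imp_trans h (hP.or_left _ _)))
    · rw [gCoimp, if_neg (mt (hg _ _).1 h)]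
      refine le_antisymm (hle _ _ (hP.coimp_imp (hP.or_right _ _))) (hle _ _ ?_)
      have hor : β.imp (γ.or (β.coimp γ)) ∈ P := hP.ax (.orCoimp _ _)
      rcases htotal γ (β.coimp γ) with h' | h'
      · exact hP.imp_trans hor (hP.or_imp h' (hP.imp_refl _))
      · exact absurd (hP.imp_trans hor (hP.or_imp (hP.imp_refl _) h')) h

/-! ### Formulas over finitely many variables -/

namespace CPL

/-- All variables of the formula are below `N`. -/
def VarsBelow (N : ℕ) : CPL → Prop
  | var p => p < N
  | neg φ => VarsBelow N φ
  | and φ χ => VarsBelow N φ ∧ VarsBelow N χ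

theorem VarsBelow.mono {N M : ℕ} (h : N ≤ M) {φ : CPL} (hφ : φ.VarsBelow N) :
    φ.VarsBelow M := by
  induction φ with
  | var p => exact lt_of_lt_of_le hφ h
  | neg φ ih => exact ih hφ
  | and φ χ ih ih' => exact ⟨ih hφ.1, ih' hφ.2⟩

theorem exists_varsBelow (φ : CPL) : ∃ N, φ.VarsBelow N := by
  induction φ with
  | var p => exact ⟨p + 1, Nat.lt_succ_self p⟩
  | neg φ ih => exact ih
  | and φ χ ih ih' =>
    obtain ⟨N, h⟩ := ih
    obtain ⟨M, h'⟩ := ih'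
    exact ⟨max N M, h.mono (le_max_left _ _), h'.mono (le_max_right _ _)⟩

/-- The states of the canonical frame: truth assignments to the first `N` variables. -/
abbrev State (N : ℕ) : Type u := ULift.{u} (Fin N → Prop)

/-- The canonical valuation; variables outside the first `N` are false everywhere. -/
def stateVal (N : ℕ) (p : ℕ) : Set (State.{u} N) := {w | ∃ hp : p < N, w.down ⟨p, hp⟩}

theorem sat_stateVal_iff_holds {N : ℕ} (a : ℕ → Prop) {φ : CPL} (hφ : φ.VarsBelow N) :
    Sat (stateVal.{u} N) ⟨fun i => a i⟩ φ ↔ Holds a φ := by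
  induction φ with
  | var p => exact ⟨fun ⟨_, h⟩ => h, fun h => ⟨hφ, h⟩⟩
  | neg φ ih => exact not_congr (ih hφ)
  | and φ χ ih ih' => exact and_congr (ih hφ.1) (ih' hφ.2)

theorem isTheorem_of_stateVal {N : ℕ} {φ : CPL} (hφ : φ.VarsBelow N)
    (h : ∀ w, Sat (stateVal.{u} N) w φ) : φ.IsTheorem :=
  fun a => (sat_stateVal_iff_holds a hφ).1 (h _)

theorem isTheorem_imp_of_ext_subset {N : ℕ} {φ χ : CPL} (hφ : φ.VarsBelow N)
    (hχ : χ.VarsBelow N) (h : ext (stateVal.{u} N) φ ⊆ ext (stateVal.{u} N) χ) :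
    (φ.imp χ).IsTheorem := fun a => by
  rw [holds_imp, ← sat_stateVal_iff_holds.{u} a hφ, ← sat_stateVal_iff_holds.{u} a hχ]
  exact fun hx => h hx

theorem varsBelow_conjOver {ι : Type} {N : ℕ} (s : Finset ι) (f : ι → CPL)
    (hN : 0 < N) (h : ∀ i, (f i).VarsBelow N) : (conjOver s f).VarsBelow N := by
  unfold conjOver
  induction s.toList with
  | nil => exact ⟨hN, hN⟩
  | cons i l ih => exact ⟨h i, ih⟩

theorem varsBelow_disjOver {ι : Type} {N : ℕ} (s : Finset ι) (f : ι → CPL)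
    (hN : 0 < N) (h : ∀ i, (f i).VarsBelow N) : (disjOver s f).VarsBelow N := by
  unfold disjOver
  induction s.toList with
  | nil => exact ⟨hN, hN⟩
  | cons i l ih => exact ⟨h i, ih⟩

/-- Every set of states is the extension of a formula. -/
theorem exists_ext_stateVal {N : ℕ} (hN : 0 < N) (X : Set (State.{u} N)) :
    ∃ φ : CPL, φ.VarsBelow N ∧ ext (stateVal.{u} N) φ = X := by
  classical
  let lit (w : Fin N → Prop) (i : Fin N) : CPL := if w i then .var i else .neg (.var i)
  refine ⟨disjOver (Finset.univ.filter fun w : Fin N → Prop => ⟨w⟩ ∈ X) fun w =>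
    conjOver Finset.univ (lit w), varsBelow_disjOver _ _ hN fun w =>
      varsBelow_conjOver _ _ hN fun i => ?_, ?_⟩
  · dsimp only [lit]
    split_ifs <;> exact i.2
  · ext ⟨x⟩
    have hlit (w : Fin N → Prop) (i : Fin N) :
        Holds (fun p => (⟨x⟩ : State.{u} N) ∈ stateVal.{u} N p) (lit w i) ↔ (w i ↔ x i) := by
      have hx : Holds (fun p => (⟨x⟩ : State.{u} N) ∈ stateVal.{u} N p) (.var i) ↔ x i :=
        ⟨fun ⟨_, h⟩ => h, fun h => ⟨i.2, h⟩⟩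
      by_cases h : w i
      · simp only [lit, if_pos h, hx]; tauto
      · simp only [lit, if_neg h, holds_neg, hx]; tauto
    change Sat _ _ _ ↔ _
    simp only [sat_eq_holds, holds_disjOver, holds_conjOver, hlit, Finset.mem_filter,
      Finset.mem_univ, true_and, forall_const]
    constructor
    · rintro ⟨w, hw, h⟩
      have : w = x := funext fun i => propext (h i)
      exact this ▸ hw
    · exact fun h => ⟨x, h, fun _ => Iff.rfl⟩

end CPL

namespace QG

/-- All variables of the formula are below `N`. -/
def VarsBelow (N : ℕ) : QG → Prop
  | B φ => φ.VarsBelow N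
  | and α β => VarsBelow N α ∧ VarsBelow N β
  | or α β => VarsBelow N α ∧ VarsBelow N β
  | imp α β => VarsBelow N α ∧ VarsBelow N β
  | coimp α β => VarsBelow N α ∧ VarsBelow N β

theorem VarsBelow.mono {N M : ℕ} (h : N ≤ M) {α : QG} (hα : α.VarsBelow N) :
    α.VarsBelow M := by
  induction α with
  | B φ => exact CPL.VarsBelow.mono h hα
  | _ α β ih ih' => exact ⟨ih hα.1, ih' hα.2⟩

theorem exists_varsBelow (α : QG) : ∃ N, α.VarsBelow N := by
  induction α with
  | B φ => exact φ.exists_varsBelow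
  | _ α β ih ih' =>
    obtain ⟨N, h⟩ := ih
    obtain ⟨M, h'⟩ := ih'
    exact ⟨max N M, h.mono (le_max_left _ _), h'.mono (le_max_right _ _)⟩

end QG

/-! ### Completeness -/

theorem isTheory_derives (Ax : Set QG) : IsTheory {α | Derives (HQG ∪ Ax) ∅ α} where
  ax h := .ax (Or.inl (.biG _ h))
  mp h h' := .mp h h'
  nec h := .nec h

theorem IsTheory.bigAnd_mem {T : Set QG} (hT : IsTheory T) {l : List QG} (h : ∀ α ∈ l, α ∈ T) :
    QG.bigAnd l ∈ T := by
  induction l with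
  | nil => exact hT.top_mem
  | cons a l ih =>
    exact hT.and_mem (h a List.mem_cons_self) (ih fun α hα => h α (List.mem_cons_of_mem _ hα))

/-- Every formula that is not derivable fails in some `QPG` frame. -/
theorem exists_countermodel {α : QG} (hα : ¬ Derives (HQG ∪ KPS) ∅ α) :
    ∃ F : Frame.{u}, IsQPGFrame F ∧ ∃ v : ℕ → Set F.W, F.eval v α ≠ 1 := by
  obtain ⟨P, hsub, hP, hαP, hprime⟩ := (isTheory_derives KPS).exists_prime hα
  obtain ⟨g, hg, hgα, hand, hor, himp, hcoimp⟩ := hP.exists_hom hαP hprime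
  obtain ⟨N₀, hN₀⟩ := α.exists_varsBelow
  obtain ⟨N, hN, hαN⟩ : ∃ N, 0 < N ∧ α.VarsBelow N :=
    ⟨N₀ + 1, Nat.succ_pos _, hN₀.mono (Nat.le_succ _)⟩
  choose form hform hext using CPL.exists_ext_stateVal.{u} hN
  have hreg {φ χ : CPL} (h : (φ.imp χ).IsTheorem) : g (.B φ) ≤ g (.B χ) :=
    (hg _ _).2 (hsub (.ax (Or.inl (.reg _ _ h))))
  have hmono {φ χ : CPL} (hφ : φ.VarsBelow N) (hχ : χ.VarsBelow N)
      (h : CPL.ext (CPL.stateVal.{u} N) φ ⊆ CPL.ext (CPL.stateVal.{u} N) χ) :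
      g (.B φ) ≤ g (.B χ) := hreg (CPL.isTheorem_imp_of_ext_subset hφ hχ h)
  let F : Frame.{u} :=
    { W := CPL.State.{u} N
      nonempty := ⟨⟨fun _ => True⟩⟩
      μ := fun X => g (.B (form X))
      mono := fun X Y h => hmono (hform X) (hform Y) (by rwa [hext, hext])
      nontriv := by
        refine not_le.1 fun h => hαP ?_
        have h1 : (form Set.univ).IsTheorem :=
          CPL.isTheorem_of_stateVal.{u} (hform _) fun w =>
            (hext Set.univ).superset (Set.mem_univ w)
        have h2 : (form ∅).neg.IsTheorem :=
          CPL.isTheorem_of_stateVal.{u} (φ := (form ∅).neg) (hform ∅) fun w hw =>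
            (hext ∅).subset hw
        have h3 := hsub (.ax (Or.inl (.nontriv _ _ h1 h2)))
        exact hP.mp (hP.mp (hP.nec ((hg _ _).1 h)) h3) (hP.bot_imp α) }
  refine ⟨F, ?_, CPL.stateVal N, ?_⟩
  · intro m X Y hle hcount
    have hcount' : (sameCount (fun i => form (X i)) fun i => form (Y i)).IsTheorem := by
      intro a
      rw [CPL.holds_sameCount]
      simp only [← CPL.sat_stateVal_iff_holds.{u} a (hform _)]
      have := hcount ⟨fun i => a i⟩
      have hmem (Z : Set (CPL.State.{u} N)) (w) :
          CPL.Sat (CPL.stateVal.{u} N) w (form Z) ↔ w ∈ Z := Set.ext_iff.1 (hext Z) w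
      simp only [hmem]
      exact this
    have hE : eG (fun i => form (X i)) (fun i => form (Y i)) ∈ P := by
      refine hP.nec (hP.and_mem ?_ ?_)
      · exact (hg _ _).1 (hreg fun a => by simp)
      · exact (hg _ _).1 (hreg fun a => by simp [hcount' a])
    have hkps := hsub (.ax (Or.inr ⟨m, fun i => form (X i), fun i => form (Y i), rfl⟩))
    refine (hg _ _).2 (hP.mp (hP.mp (hP.and_mem hE (hP.bigAnd_mem ?_)) hkps) (hP.delta_imp _))
    intro β hβ
    obtain ⟨i, -, rfl⟩ := List.mem_map.1 hβ
    exact hP.nec ((hg _ _).1 (hle i))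
  · have key (β : QG) (hβ : β.VarsBelow N) : F.eval (CPL.stateVal N) β = g β := by
      induction β with
      | B φ =>
        exact le_antisymm (hmono (hform _) hβ (hext _).subset)
          (hmono hβ (hform _) (hext _).superset)
      | and β γ ih ih' => rw [Frame.eval_and, ih hβ.1, ih' hβ.2, hand]
      | or β γ ih ih' => rw [Frame.eval_or, ih hβ.1, ih' hβ.2, hor]
      | imp β γ ih ih' => rw [Frame.eval_imp, ih hβ.1, ih' hβ.2, himp]
      | coimp β γ ih ih' => rw [Frame.eval_coimp, ih hβ.1, ih' hβ.2, hcoimp]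
    rwa [key α hαN]

theorem derives_iff_validates (α : QG) :
    Derives (HQG ∪ KPS) ∅ α ↔ ∀ F : Frame.{u}, IsQPGFrame F → F.Validates α := by
  constructor
  · intro h F hF v
    have := h.sInf_le_eval hF v
    rw [Set.image_empty, sInf_empty] at this
    exact (Frame.one_le_eval F v).1 this
  · intro h
    by_contra hα
    obtain ⟨F, hF, v, hv⟩ := exists_countermodel.{u} hα
    exact hv (h F hF v)

theorem Derives.weaken {Ax Ξ : Set QG} {α : QG} (h : Derives Ax ∅ α) : Derives Ax Ξ α := by
  generalize hE : (∅ : Set QG) = E at h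
  induction h with
  | ax h => exact .ax h
  | prem h => subst hE; exact absurd h (Set.notMem_empty _)
  | mp _ _ ih ih' => exact .mp (ih hE) (ih' hE)
  | nec h _ => exact .nec h

theorem Derives.bigAnd {Ξ : Set QG} {l : List QG} (h : ∀ α ∈ l, α ∈ Ξ) :
    Derives (HQG ∪ KPS) Ξ (QG.bigAnd l) := by
  have hT := isTheory_derives KPS
  induction l with
  | nil => exact Derives.weaken hT.top_mem
  | cons a l ih =>
    have pair : Derives (HQG ∪ KPS) ∅ (a.imp ((QG.bigAnd l).imp (a.and (QG.bigAnd l)))) :=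
      hT.curry (hT.imp_refl _)
    exact .mp (ih fun α hα => h α (List.mem_cons_of_mem _ hα))
      (.mp (.prem (h a List.mem_cons_self)) pair.weaken)

theorem derives_iff_entails {Ξ : Set QG} (hΞ : Ξ.Finite) (α : QG) :
    Derives (HQG ∪ KPS) Ξ α ↔ EntailsQPG.{u} Ξ α := by
  constructor
  · exact fun h F hF v => h.sInf_le_eval hF v
  · intro h
    have hmem (β : QG) : β ∈ hΞ.toFinset.toList ↔ β ∈ Ξ := by simp
    refine .mp (Derives.bigAnd fun β hβ => (hmem β).1 hβ)
      (Derives.weaken ((derives_iff_validates.{u} _).2 fun F hF v => ?_))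
    rw [Frame.eval_imp_eq_one]
    refine le_trans (le_sInf ?_) (h F hF v)
    rintro _ ⟨β, hβ, rfl⟩
    exact (Frame.le_eval_bigAnd F v).1 le_rfl β ((hmem β).2 hβ)

end QualProb

theorem mainTheorem2 :
    (∀ F : QualProb.Frame.{u},
      (∀ α ∈ QualProb.KPS, F.Validates α) ↔ F.SatisfiesKPS) ∧
    (∀ α : QualProb.QG,
      QualProb.Derives (QualProb.HQG ∪ QualProb.KPS) ∅ α ↔
        ∀ F : QualProb.Frame.{u}, QualProb.IsQPGFrame F → F.Validates α) ∧
    (∀ (Ξ : Set QualProb.QG) (α : QualProb.QG), Ξ.Finite →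
      (QualProb.Derives (QualProb.HQG ∪ QualProb.KPS) Ξ α ↔
        QualProb.EntailsQPG.{u} Ξ α)) :=
  ⟨fun _ => ⟨QualProb.Frame.satisfiesKPS_of_validates, fun hF _ hα => hF.validates hα⟩,
    QualProb.derives_iff_validates, fun _ α hΞ => QualProb.derives_iff_entails hΞ α⟩
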